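/- Let $\lambda=(\lambda_n)_{n\ge 1}$ be a frequency, i.e. a strictly increasing sequence of non-negative real numbers tending to $+\infty$. Say that $\lambda$ satisfies (LC) if for every $\delta>0$ there is $C>0$ such that $\lambda_{n+1}-\lambda_n\ge Ce^{-e^{\delta\lambda_n}}$ for all $n\in\mathbb N$; (BC) if there is $l>0$ such that for every $\delta>0$ there is $C>0$ with $\lambda_{n+1}-\lambda_n\ge Ce^{-(l+\delta)\lambda_n}$ for all $n\in\mathbb N$. A $\lambda$-Dirichlet group is a pair $(G,\beta)$ of a compact (Hausdorff) abelian group $G$ and a continuous homomorphism $\beta:(\mathbb R,+)\to G$ with dense range such that for every $n$ there is a (necessarily unique) continuous character $h_{\lambda_n}$ of $G$ with $h_{\lambda_n}(\beta(t))=e^{-i\lambda_n t}$ for all $t\in\mathbb R$. Let $H_\infty^\lambda(G)$ be the space of all $f\in L_\infty(G)$ (with respect to normalized Haar measure) whose Fourier coefficients $\widehat f(\chi)=\int_G f\,\overline{\chi}$ vanish for all continuous characters $\chi\notin\{h_{\lambda_n}:n\in\mathbb N\}$. Let $\mathcal H_\infty(\lambda)$ be the space of all formal series $D=\sum a_n(D)e^{-\lambda_n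 s}$ for which there is a (necessarily unique) $f\in H_\infty^\lambda(G)$ with $a_n(D)=\widehat f(h_{\lambda_n})$ for all $n$, and put $\|D\|_\infty=\|f\|_{L_\infty(G)}$. (1) If $\lambda$ satisfies (LC), then for every $\delta>0$ there is a constant $C=C(\delta,\lambda)>0$ such that for every $\lambda$-Dirichlet group $(G,\beta)$, every $D\in\mathcal H_\infty(\lambda)$ and every $N\in\mathbb N$ $$\Big\|\sum_{n=1}^N a_n(D)e^{-\lambda_n s}\Big\|_\infty\le C e^{\delta\lambda_N}\|D\|_\infty .$$ (2) If $\lambda$ satisfies (BC), then there is a constant $C_1=C_1(\lambda)>0$ such that for every $\lambda$-Dirichlet group $(G,\beta)$, every $D\in\mathcal H_\infty(\lambda)$ and every $N\in\mathbb N$ with $\lambda_N>0$ (that is, every $N$, except $N=1$ if $\lambda_1=0$) $$\Big\|\sum_{n=1}^N a_n(D)e^{-\lambda_n s}\Big\|_\infty\le C_1\lambda_N\|D\|_\infty .$$ Both estimates hold for the norm of the partial sum in $\mathcal H_\infty(\lambda)$ as well as for its supremum norm on the half-plane $\{\operatorname{Re}s>0\}$. -/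

import Mathlib

open MeasureTheory Filter Topology
open scoped ENNReal ComplexConjugate

namespace GeneralDirichlet

/-- A frequency: a strictly increasing, non-negative real sequence tending to `+∞`. The index starts
at `0`, so `lam n` is the `(n+1)`-st frequency. -/
structure IsFrequency (lam : ℕ → ℝ) : Prop where
  strictMono : StrictMono lam
  nonneg : ∀ n, 0 ≤ lam n
  tendsto : Tendsto lam atTop atTop

/-- Landau's condition (LC). -/
def LandauCondition (lam : ℕ → ℝ) : Prop :=
  ∀ δ : ℝ, 0 < δ → ∃ C : ℝ, 0 < C ∧
    ∀ n : ℕ, C * Real.exp (-Real.exp (δ * lam n)) ≤ lam (n + 1) - lam n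

/-- Bohr's condition (BC). -/
def BohrCondition (lam : ℕ → ℝ) : Prop :=
  ∃ l : ℝ, 0 < l ∧ ∀ δ : ℝ, 0 < δ → ∃ C : ℝ, 0 < C ∧
    ∀ n : ℕ, C * Real.exp (-(l + δ) * lam n) ≤ lam (n + 1) - lam n

/-- The structure of a `lam`-Dirichlet group on a compact abelian group `G`: a continuous
homomorphism `β : (ℝ, +) → G` with dense range, such that every character `t ↦ e^{-i lam n t}` of
`ℝ` factors as `h n ∘ β` for a continuous character `h n` of `G`. (As `β` has dense range, `h n` is
determined by `β`, so that the field `h` is no extra choice.) -/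
structure LambdaDirichletGroup (lam : ℕ → ℝ) (G : Type*) [CommGroup G] [TopologicalSpace G] where
  β : Multiplicative ℝ →* G
  continuous_β : Continuous β
  denseRange_β : DenseRange β
  h : ℕ → (G →ₜ* Circle)
  h_β : ∀ (n : ℕ) (t : ℝ), h n (β (Multiplicative.ofAdd t)) = Circle.exp (-(lam n * t))

section Hardy

variable (G : Type*) [CommGroup G] [TopologicalSpace G] [IsTopologicalGroup G] [CompactSpace G]
  [MeasurableSpace G] [BorelSpace G]

/-- The normalized Haar measure of the compact group `G` (total mass `1`). -/
noncomputable def haarG : Measure G := Measure.haarMeasure ⊤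

variable {G}

/-- The Fourier coefficient `∫ f(ω) * conj (χ(ω)) dω` of `f` at the character `χ`. -/
noncomputable def fourierCoeffG (f : G → ℂ) (χ : G →ₜ* Circle) : ℂ :=
  ∫ ω, f ω * conj (χ ω : ℂ) ∂(haarG G)

variable {lam : ℕ → ℝ}

/-- The Hardy space `H_p^lam(G)`: all functions in `L_p(G)` whose Fourier transform is supported on
`{h n : n ∈ ℕ}`. -/
def hardySpace (𝓖 : LambdaDirichletGroup lam G) (p : ℝ≥0∞) : Set (Lp ℂ p (haarG G)) :=
  {f | ∀ χ : G →ₜ* Circle, χ ∉ Set.range 𝓖.h → fourierCoeffG f χ = 0}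

/-- The function `f ∈ H_p^lam(G)` is associated with the formal Dirichlet series
`∑ a n * e^{-lam n * s}`, that is, the Bohr map sends `f` to this series. -/
def IsAssociated (𝓖 : LambdaDirichletGroup lam G) (p : ℝ≥0∞) (a : ℕ → ℂ)
    (f : Lp ℂ p (haarG G)) : Prop :=
  f ∈ hardySpace 𝓖 p ∧ ∀ n, a n = fourierCoeffG f (𝓖.h n)

/-- The formal Dirichlet series `∑ a n * e^{-lam n * s}` belongs to `𝓗_p(lam)`. -/
def MemHardy (𝓖 : LambdaDirichletGroup lam G) (p : ℝ≥0∞) (a : ℕ → ℂ) : Prop :=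
  ∃ f, IsAssociated 𝓖 p a f

/-- The norm of `𝓗_p(lam)`: the `L_p`-norm of the (unique) associated function, and `∞` if there is
none. -/
noncomputable def hardyNorm (𝓖 : LambdaDirichletGroup lam G) (p : ℝ≥0∞) (a : ℕ → ℂ) : ℝ≥0∞ :=
  ⨅ (f : Lp ℂ p (haarG G)) (_ : IsAssociated 𝓖 p a f), eLpNorm f p (haarG G)

end Hardy

/-- The coefficients of the partial sum `∑_{n ≤ N} a n * e^{-lam n * s}`, as a formal series. -/
def partialSum (a : ℕ → ℂ) (N : ℕ) : ℕ → ℂ := fun n => if n ≤ N then a n else 0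

/-- The sup norm on the open right half-plane of `s ↦ ∑_{n ≤ N} a n * e^{-lam n * s}`. -/
noncomputable def partialSumSupNorm (lam : ℕ → ℝ) (a : ℕ → ℂ) (N : ℕ) : ℝ≥0∞ :=
  ⨆ (s : ℂ) (_ : 0 < s.re), ‖∑ n ∈ Finset.range (N + 1), a n * Complex.exp (-(lam n : ℂ) * s)‖ₑ

end GeneralDirichlet

universe u

open GeneralDirichlet

/-! On the Fourier side, the `N`-th partial sum is cut out by any multiplier that is `1` on `[-lam
N, lam N]` and `0` beyond `lam (N + 1)`. A trapezoid whose flank has width `d`, at most the gap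
after `lam N`, is such a multiplier. Its Fourier transform `V` has `L₁`-norm at most `4 + 4 * lam N
+ 2 * log (1 / d)` (`exists_kernel`). Averaging `f` against `V` along the flow `β` yields the
partial sum, so its sup norm is at most `‖V‖₁ ‖f‖_∞`. The logarithm turns the gap bound of (LC) into
`exp (δ * lam N)` and that of (BC) into a multiple of `lam N`.

The average is never formed as a function on `G`. It is only paired with trigonometric polynomials
`g` (`integral_kernel_mul_eq`), where it suffices to check characters. The sup norm is recovered by
choosing `g = conj S ^ (k + 1) * S ^ k`, with `S` the partial sum itself: this gives moment
inequalities that force `|S| ≤ c` (`norm_le_of_moments`). The half-plane bound follows because `S ∘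
β` is the Dirichlet polynomial on the imaginary axis. -/

namespace GeneralDirichlet
open scoped FourierTransform

/-! ### Trapezoidal multipliers and the `L₁`-norm of their Fourier transforms -/

/-- The trapezoid which is `1` on `[-a, a]` and vanishes off `[-(a + d), a + d]`. -/
noncomputable def trapezoid (a d : ℝ) (x : ℝ) : ℂ :=
  ((max 0 (min 1 ((a + d - |x|) / d)) : ℝ) : ℂ)

lemma continuous_trapezoid (a d : ℝ) : Continuous (trapezoid a d) := by
  unfold trapezoid
  fun_prop

lemma trapezoid_eq_one {a d x : ℝ} (hd : 0 < d) (hx : |x| ≤ a) : trapezoid a d x = 1 := by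
  have h : 1 ≤ (a + d - |x|) / d := by rw [le_div_iff₀ hd]; linarith
  simp [trapezoid, min_eq_left h]

lemma trapezoid_eq_zero {a d x : ℝ} (hd : 0 < d) (hx : a + d ≤ |x|) : trapezoid a d x = 0 := by
  have h : (a + d - |x|) / d ≤ 0 := div_nonpos_of_nonpos_of_nonneg (by linarith) hd.le
  simp [trapezoid, min_eq_right (h.trans zero_le_one), max_eq_left h]

lemma trapezoid_eq_of_mem {a d x : ℝ} (hd : 0 < d) (h1 : a ≤ |x|) (h2 : |x| ≤ a + d) :
    trapezoid a d x = (a + d - |x| : ℝ) / d := by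
  have h : (a + d - |x|) / d ≤ 1 := by rw [div_le_one hd]; linarith
  have h' : 0 ≤ (a + d - |x|) / d := div_nonneg (by linarith) hd.le
  simp [trapezoid, min_eq_right h, max_eq_right h']

lemma support_trapezoid_subset {a d : ℝ} (hd : 0 < d) :
    Function.support (trapezoid a d) ⊆ Set.Ioc (-(a + d)) (a + d) := by
  intro x hx
  by_contra h
  apply hx
  apply trapezoid_eq_zero hd
  by_contra! h'
  exact h ⟨(abs_lt.1 h').1, (abs_lt.1 h').2.le⟩

lemma integrable_trapezoid {a d : ℝ} (hd : 0 < d) : Integrable (trapezoid a d) := by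
  apply (continuous_trapezoid a d).integrable_of_hasCompactSupport
  exact HasCompactSupport.of_support_subset_isCompact isCompact_Icc
    ((support_trapezoid_subset hd).trans Set.Ioc_subset_Icc_self)

lemma integral_exp_mul_trapezoid {a d : ℝ} (ha : 0 ≤ a) (hd : 0 < d) {k : ℂ} (hk : k ≠ 0) :
    ∫ x : ℝ, Complex.exp (k * x) * trapezoid a d x =
      (Complex.exp (k * (a + d)) + Complex.exp (-(k * (a + d))) - Complex.exp (k * a)
        - Complex.exp (-(k * a))) / (d * k ^ 2) := by
  have hdc : (d : ℂ) ≠ 0 := by exact_mod_cast hd.ne'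
  have hcont : Continuous fun x : ℝ => Complex.exp (k * x) * trapezoid a d x :=
    (by fun_prop : Continuous fun x : ℝ => Complex.exp (k * x)).mul (continuous_trapezoid a d)
  have hi : ∀ u v : ℝ, IntervalIntegrable (fun x : ℝ => Complex.exp (k * x) * trapezoid a d x)
    volume u v := fun u v => hcont.intervalIntegrable u v
  have hexp : ∀ x : ℝ, HasDerivAt (fun y : ℝ => Complex.exp (k * y)) (Complex.exp (k * x) * k) x := by
    intro x
    simpa using ((hasDerivAt_id (x : ℂ)).const_mul k).cexp.comp_ofReal
  have hsub : Function.support (fun x : ℝ => Complex.exp (k * x) * trapezoid a d x) ⊆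
      Set.Ioc (-(a + d)) (a + d) := by
    refine Set.Subset.trans ?_ (support_trapezoid_subset hd)
    exact Function.support_mul_subset_right _ _
  rw [← intervalIntegral.integral_eq_integral_of_support_subset hsub,
    ← intervalIntegral.integral_add_adjacent_intervals (hi _ (-a)) (hi _ _),
    ← intervalIntegral.integral_add_adjacent_intervals (hi (-a) a) (hi _ _)]
  have e1 : ∫ x in (-(a + d))..(-a), Complex.exp (k * x) * trapezoid a d x =
      Complex.exp (-(k * a)) * (1 / k - 1 / (d * k ^ 2)) + Complex.exp (-(k * (a + d))) / (d * k ^ 2) := by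
    rw [intervalIntegral.integral_congr
      (g := fun x : ℝ => Complex.exp (k * x) * ((a + d + x) / d))]
    · rw [intervalIntegral.integral_eq_sub_of_hasDerivAt
        (f := fun x : ℝ => Complex.exp (k * x) * ((a + d + x) / (d * k) - 1 / (d * k ^ 2)))]
      · push_cast
        rw [show k * -(a : ℂ) = -(k * a) by ring, show k * -((a : ℂ) + d) = -(k * (a + d)) by ring]
        field_simp
        ring
      · intro x _
        have h2 : HasDerivAt (fun x : ℝ => ((a + d + x) / (d * k) - 1 / (d * k ^ 2) : ℂ))
            (1 / (d * k)) x := by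
          simpa using ((((hasDerivAt_id (x : ℂ)).const_add ((a : ℂ) + d)).div_const
            ((d : ℂ) * k)).sub_const (1 / (d * k ^ 2) : ℂ)).comp_ofReal
        refine ((hexp x).mul h2).congr_deriv ?_
        field_simp
        ring
      · apply Continuous.intervalIntegrable
        fun_prop
    · intro x hx
      rw [Set.uIcc_of_le (by linarith)] at hx
      have hx0 : |x| = -x := abs_of_nonpos (by linarith [hx.2])
      simp only
      rw [trapezoid_eq_of_mem hd (by linarith [hx.2]) (by linarith [hx.1]), hx0]
      push_cast
      ring
  have e2 : ∫ x in (-a)..a, Complex.exp (k * x) * trapezoid a d x =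
      (Complex.exp (k * a) - Complex.exp (-(k * a))) / k := by
    rw [intervalIntegral.integral_congr (g := fun x : ℝ => Complex.exp (k * x)),
      integral_exp_mul_complex hk]
    · push_cast
      rw [show k * -(a : ℂ) = -(k * a) by ring]
    · intro x hx
      rw [Set.uIcc_of_le (by linarith)] at hx
      simp only
      rw [trapezoid_eq_one hd (abs_le.2 hx), mul_one]
  have e3 : ∫ x in a..(a + d), Complex.exp (k * x) * trapezoid a d x =
      Complex.exp (k * (a + d)) / (d * k ^ 2) - Complex.exp (k * a) * (1 / k + 1 / (d * k ^ 2)) := by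
    rw [intervalIntegral.integral_congr
      (g := fun x : ℝ => Complex.exp (k * x) * ((a + d - x) / d))]
    · rw [intervalIntegral.integral_eq_sub_of_hasDerivAt
        (f := fun x : ℝ => Complex.exp (k * x) * ((a + d - x) / (d * k) + 1 / (d * k ^ 2)))]
      · push_cast
        field_simp
        ring
      · intro x _
        have h2 : HasDerivAt (fun x : ℝ => ((a + d - x) / (d * k) + 1 / (d * k ^ 2) : ℂ))
            (-1 / (d * k)) x := by
          simpa using ((((hasDerivAt_id (x : ℂ)).const_sub ((a : ℂ) + d)).div_const
            ((d : ℂ) * k)).add_const (1 / (d * k ^ 2) : ℂ)).comp_ofReal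
        refine ((hexp x).mul h2).congr_deriv ?_
        field_simp
        ring
      · apply Continuous.intervalIntegrable
        fun_prop
    · intro x hx
      rw [Set.uIcc_of_le (by linarith)] at hx
      have hx0 : |x| = x := abs_of_nonneg (by linarith [hx.1])
      simp only
      rw [trapezoid_eq_of_mem hd (by linarith [hx.1]) (by linarith [hx.2]), hx0]
      push_cast
      ring
  rw [e1, e2, e3]
  field_simp
  ring

/-- Integrating the three linear pieces leaves a difference of cosines at `a + d` and `a`; the
sum-to-product formula makes it a product of two sines, which can then be estimated separately. -/
lemma norm_fourier_trapezoid {a d w : ℝ} (ha : 0 ≤ a) (hd : 0 < d) (hw : w ≠ 0) :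
    ‖𝓕 (trapezoid a d) w‖ =
      |Real.sin (Real.pi * (2 * a + d) * w)| * |Real.sin (Real.pi * d * w)|
        / (Real.pi ^ 2 * d * w ^ 2) := by
  have hpi := Real.pi_pos
  set k : ℂ := ((-2 * Real.pi * w : ℝ) : ℂ) * Complex.I with hkdef
  have hk : k ≠ 0 := by
    apply mul_ne_zero _ Complex.I_ne_zero
    exact_mod_cast mul_ne_zero (mul_ne_zero (by norm_num) hpi.ne') hw
  have hcos : ∀ s : ℝ, Complex.exp (k * s) + Complex.exp (-(k * s)) =
      ((2 * Real.cos (2 * Real.pi * w * s) : ℝ) : ℂ) := by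
    intro s
    push_cast
    rw [Complex.two_cos, add_comm]
    congr 2 <;> (rw [hkdef]; push_cast; ring)
  have hF : 𝓕 (trapezoid a d) w =
      ((2 * (Real.cos (2 * Real.pi * w * (a + d)) - Real.cos (2 * Real.pi * w * a)) /
        (d * -(4 * Real.pi ^ 2 * w ^ 2)) : ℝ) : ℂ) := by
    rw [Real.fourier_real_eq_integral_exp_smul]
    have : ∀ v : ℝ, Complex.exp (((-2 * Real.pi * v * w : ℝ) : ℂ) * Complex.I) • trapezoid a d v
        = Complex.exp (k * v) * trapezoid a d v := by
      intro v
      rw [smul_eq_mul, hkdef]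
      push_cast
      ring_nf
    simp_rw [this]
    rw [integral_exp_mul_trapezoid ha hd hk]
    have h1 := hcos (a + d)
    have h2 := hcos a
    have h3 : k ^ 2 = ((-(4 * Real.pi ^ 2 * w ^ 2) : ℝ) : ℂ) := by
      rw [hkdef, mul_pow, Complex.I_sq]; push_cast; ring
    rw [h3]
    push_cast at h1 h2 ⊢
    congr 1
    linear_combination h1 - h2
  have hden : 0 < Real.pi ^ 2 * d * w ^ 2 := by positivity
  rw [hF, Complex.norm_real, Real.norm_eq_abs, Real.cos_sub_cos,
    show (2 * Real.pi * w * (a + d) + 2 * Real.pi * w * a) / 2 = Real.pi * (2 * a + d) * w by ring,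
    show (2 * Real.pi * w * (a + d) - 2 * Real.pi * w * a) / 2 = Real.pi * d * w by ring,
    ← abs_mul, eq_div_iff hden.ne']
  conv_lhs => arg 2; rw [← abs_of_pos hden]
  rw [← abs_mul]
  congr 1
  field_simp
  ring

/-- A majorant on `(0, ∞)` of the modulus of the Fourier transform of a trapezoid. -/
noncomputable def kernelMajorant (c d : ℝ) (w : ℝ) : ℝ :=
  (Set.Ioc 0 (1 / c)).indicator (fun _ => c) w + (Set.Ioc (1 / c) (1 / d)).indicator (fun w => 1 / w) w
    + (Set.Ioi (1 / d)).indicator (fun w => d⁻¹ * w ^ (-2 : ℝ)) w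

/-- Each sine is bounded either by its argument or by `1`: both by the argument for small `w`, only
the one with frequency `d` in the middle range, neither for large `w`. The middle range produces the
logarithm. -/
lemma norm_fourier_trapezoid_le {a d w : ℝ} (ha : 0 ≤ a) (hd : 0 < d) (hw : 0 < w) :
    ‖𝓕 (trapezoid a d) w‖ ≤ kernelMajorant (2 * a + d) d w := by
  have hpi := Real.pi_pos
  have hpi3 := Real.pi_gt_three
  have hc : 0 < 2 * a + d := by linarith
  rw [norm_fourier_trapezoid ha hd hw.ne']
  have s1 : |Real.sin (Real.pi * (2 * a + d) * w)| ≤ Real.pi * (2 * a + d) * w :=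
    (Real.abs_sin_le_abs).trans_eq (abs_of_pos (by positivity))
  have s2 : |Real.sin (Real.pi * d * w)| ≤ Real.pi * d * w :=
    (Real.abs_sin_le_abs).trans_eq (abs_of_pos (by positivity))
  have s1' := Real.abs_sin_le_one (Real.pi * (2 * a + d) * w)
  have s2' := Real.abs_sin_le_one (Real.pi * d * w)
  have hdc : 1 / (2 * a + d) ≤ 1 / d := one_div_le_one_div_of_le hd (by linarith)
  rw [div_le_iff₀ (by positivity)]
  unfold kernelMajorant
  rcases le_or_gt w (1 / (2 * a + d)) with h1 | h1
  · rw [Set.indicator_of_mem (by exact ⟨hw, h1⟩), Set.indicator_of_notMem (by simp; intro h; simp at h1; linarith),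
      Set.indicator_of_notMem (by simp; simp at h1 hdc; linarith)]
    calc _ ≤ (Real.pi * (2 * a + d) * w) * (Real.pi * d * w) := by gcongr
      _ = _ := by ring
  rcases le_or_gt w (1 / d) with h2 | h2
  · rw [Set.indicator_of_notMem (by simp; intro; simpa using h1), Set.indicator_of_mem (by exact ⟨h1, h2⟩),
      Set.indicator_of_notMem (by simpa using h2)]
    calc _ ≤ 1 * (Real.pi * d * w) := by gcongr
      _ ≤ Real.pi * (Real.pi * d * w) := by gcongr; linarith
      _ = _ := by field_simp; ring
  · rw [Set.indicator_of_notMem (by simp; intro; simpa using h1),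
      Set.indicator_of_notMem (by simp; intro; simpa using h2), Set.indicator_of_mem (by exact h2)]
    calc _ ≤ (1 : ℝ) * 1 := by gcongr
      _ ≤ Real.pi ^ 2 := by nlinarith
      _ = _ := by
        rw [Real.rpow_neg hw.le, Real.rpow_two]
        field_simp
        ring

lemma kernelMajorant_integral {c d : ℝ} (hd : 0 < d) (hcd : d ≤ c) :
    IntegrableOn (kernelMajorant c d) (Set.Ioi 0) ∧
      ∫ w in Set.Ioi 0, kernelMajorant c d w = 2 + Real.log (c / d) := by
  have hc : 0 < c := hd.trans_le hcd
  have hdc : 1 / c ≤ 1 / d := one_div_le_one_div_of_le hd hcd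
  have hc' : 0 < 1 / c := by positivity
  have hd' : 0 < 1 / d := by positivity
  have i1 : IntegrableOn (fun _ : ℝ => c) (Set.Ioc 0 (1 / c)) := by simp
  have i2 : IntegrableOn (fun w : ℝ => 1 / w) (Set.Ioc (1 / c) (1 / d)) := by
    rw [← intervalIntegrable_iff_integrableOn_Ioc_of_le hdc]
    apply ContinuousOn.intervalIntegrable
    apply ContinuousOn.div continuousOn_const continuousOn_id
    intro x hx
    rw [Set.uIcc_of_le hdc] at hx
    exact (hc'.trans_le hx.1).ne'
  have i3 : IntegrableOn (fun w : ℝ => d⁻¹ * w ^ (-2 : ℝ)) (Set.Ioi (1 / d)) :=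
    (integrableOn_Ioi_rpow_of_lt (by norm_num) hd').const_mul _
  have j1 := i1.integrable_indicator measurableSet_Ioc
  have j2 := i2.integrable_indicator measurableSet_Ioc
  have j3 := i3.integrable_indicator measurableSet_Ioi
  refine ⟨((j1.add j2).add j3).integrableOn, ?_⟩
  have hsum : kernelMajorant c d = fun w => ((Set.Ioc 0 (1 / c)).indicator (fun _ => c)
      + (Set.Ioc (1 / c) (1 / d)).indicator (fun w => 1 / w)) w
      + (Set.Ioi (1 / d)).indicator (fun w => d⁻¹ * w ^ (-2 : ℝ)) w := rfl
  rw [hsum, integral_add (j1.add j2).integrableOn j3.integrableOn,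
    integral_add' j1.integrableOn j2.integrableOn, setIntegral_indicator measurableSet_Ioc,
    setIntegral_indicator measurableSet_Ioc, setIntegral_indicator measurableSet_Ioi,
    Set.inter_eq_right.2 Set.Ioc_subset_Ioi_self,
    Set.inter_eq_right.2 (Set.Ioc_subset_Ioi_self.trans (Set.Ioi_subset_Ioi hc'.le)),
    Set.inter_eq_right.2 (Set.Ioi_subset_Ioi hd'.le), integral_const_mul,
    integral_Ioi_rpow_of_lt (by norm_num) hd', ← intervalIntegral.integral_of_le hdc,
    integral_one_div_of_pos hc' hd']
  have e1 : (1 / d) / (1 / c) = c / d := by field_simp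
  have e2 : (1 / d) ^ ((-2 : ℝ) + 1) = d := by
    rw [show (-2 : ℝ) + 1 = -1 by norm_num, Real.rpow_neg_one]; simp
  rw [e1, e2]
  simp [hc.le, hc.ne']
  field_simp
  ring

lemma integral_norm_fourier_trapezoid {a d : ℝ} (ha : 0 ≤ a) (hd : 0 < d) :
    Integrable (𝓕 (trapezoid a d)) ∧
      ∫ w, ‖𝓕 (trapezoid a d) w‖ ≤ 4 + 2 * Real.log ((2 * a + d) / d) := by
  have hcont : Continuous (𝓕 (trapezoid a d)) :=
    VectorFourier.fourierIntegral_continuous Real.continuous_fourierChar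
      (by exact continuous_inner) (integrable_trapezoid hd)
  obtain ⟨hm, hmi⟩ := kernelMajorant_integral (c := 2 * a + d) hd (by linarith)
  -- The majorant only controls `w > 0`; evenness transfers integrability and the bound to the whole
  -- line, doubling the integral.
  have heven : ∀ w, ‖𝓕 (trapezoid a d) |w|‖ = ‖𝓕 (trapezoid a d) w‖ := by
    intro w
    rcases eq_or_ne w 0 with rfl | hw
    · simp
    · rcases abs_choice w with h | h <;> rw [h]
      rw [norm_fourier_trapezoid ha hd hw, norm_fourier_trapezoid ha hd (neg_ne_zero.2 hw)]
      simp
  have hpos : IntegrableOn (𝓕 (trapezoid a d)) (Set.Ioi 0) := by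
    refine hm.mono' hcont.aestronglyMeasurable ?_
    exact (ae_restrict_iff' measurableSet_Ioi).2
      (Eventually.of_forall fun w hw => norm_fourier_trapezoid_le ha hd hw)
  refine ⟨?_, ?_⟩
  · rw [← integrable_norm_iff hcont.aestronglyMeasurable]
    have habs : IntegrableOn (fun w => ‖𝓕 (trapezoid a d) |w|‖) (Set.Ioi 0) := by
      refine IntegrableOn.congr_fun (f := fun w => ‖𝓕 (trapezoid a d) w‖) hpos.norm
        (fun w hw => ?_) measurableSet_Ioi
      simp only
      rw [abs_of_pos hw]
    rw [← funext heven, ← integrableOn_univ, ← Set.Iic_union_Ioi (a := (0 : ℝ)), integrableOn_union]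
    refine ⟨?_, habs⟩
    rw [← Measure.map_neg_eq_self (volume : Measure ℝ)]
    have m : MeasurableEmbedding fun x : ℝ => -x := (Homeomorph.neg ℝ).measurableEmbedding
    rw [m.integrableOn_map_iff]
    simp_rw [Function.comp_def, abs_neg, Set.neg_preimage, Set.neg_Iic, neg_zero]
    exact Iff.mpr integrableOn_Ici_iff_integrableOn_Ioi habs
  · rw [← funext heven, integral_comp_abs (f := fun w => ‖𝓕 (trapezoid a d) w‖)]
    have := setIntegral_mono_on hpos.norm hm measurableSet_Ioi
      (fun w hw => norm_fourier_trapezoid_le ha hd hw)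
    linarith

/-- De la Vallée-Poussin type kernels: an integrable function on `ℝ` whose inverse Fourier transform
is `1` on `[-a, a]` and `0` off `(-(a + d), a + d)`, with a logarithmic bound of its `L₁`-norm. -/
theorem exists_kernel {a d : ℝ} (ha : 0 ≤ a) (hd : 0 < d) (hd1 : d ≤ 1) :
    ∃ V : ℝ → ℂ, Integrable V ∧ ∫ w, ‖V w‖ ≤ 4 + 4 * a + 2 * Real.log (1 / d) ∧
      (∀ x, |x| ≤ a → ∫ w, V w * Complex.exp (2 * Real.pi * x * w * Complex.I) = 1) ∧
      (∀ x, a + d ≤ |x| → ∫ w, V w * Complex.exp (2 * Real.pi * x * w * Complex.I) = 0) := by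
  obtain ⟨hV, hVn⟩ := integral_norm_fourier_trapezoid ha hd
  have hinv := (continuous_trapezoid a d).fourierInv_fourier_eq (integrable_trapezoid hd) hV
  have key : ∀ x : ℝ, ∫ w, 𝓕 (trapezoid a d) w * Complex.exp (2 * Real.pi * x * w * Complex.I)
      = trapezoid a d x := by
    intro x
    conv_rhs => rw [← hinv, Real.fourierInv_eq']
    refine integral_congr_ae (Eventually.of_forall fun w => ?_)
    simp only [smul_eq_mul]
    rw [mul_comm]
    congr 2
    simp
    ring
  refine ⟨_, hV, hVn.trans ?_, fun x hx => ?_, fun x hx => ?_⟩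
  · have h1 : Real.log ((2 * a + d) / d) ≤ Real.log ((2 * a + 1) * (1 / d)) := by
      apply Real.log_le_log (by positivity)
      rw [div_eq_mul_one_div]
      gcongr
    rw [Real.log_mul (by positivity) (by positivity)] at h1
    -- The crude bound `log (2 * a + 1) ≤ 2 * a` costs nothing, as a term linear in `lam N` is
    -- allowed in both final estimates.
    have h2 := Real.log_le_sub_one_of_pos (show 0 < 2 * a + 1 by positivity)
    linarith
  · rw [key, trapezoid_eq_one hd hx]
  · rw [key, trapezoid_eq_zero hd hx]

end GeneralDirichlet

/-! ### From the imaginary axis to the half-plane -/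

namespace GeneralDirichlet

set_option linter.unusedSectionVars false

/-- Non-negative frequencies make the polynomial bounded on the right half-plane, so
Phragmén–Lindelöf applies with trivial growth. -/
lemma norm_sum_exp_le_of_imaginary_axis {lam : ℕ → ℝ} (hlam : ∀ n, 0 ≤ lam n) (b : ℕ → ℂ) (N : ℕ)
    {c : ℝ} (h : ∀ t : ℝ, ‖∑ n ∈ Finset.range N, b n * Complex.exp (-(lam n : ℂ) * (t * Complex.I))‖ ≤ c)
    {s : ℂ} (hs : 0 ≤ s.re) :
    ‖∑ n ∈ Finset.range N, b n * Complex.exp (-(lam n : ℂ) * s)‖ ≤ c := by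
  have hbdd : ∀ z : ℂ, 0 ≤ z.re → ‖∑ n ∈ Finset.range N, b n * Complex.exp (-(lam n : ℂ) * z)‖
      ≤ ∑ n ∈ Finset.range N, ‖b n‖ := by
    intro z hz
    refine (norm_sum_le _ _).trans (Finset.sum_le_sum fun n _ => ?_)
    rw [norm_mul, Complex.norm_exp]
    refine mul_le_of_le_one_right (norm_nonneg _) (Real.exp_le_one_iff.2 ?_)
    simpa using mul_nonneg (hlam n) hz
  refine PhragmenLindelof.right_half_plane_of_bounded_on_real
    (f := fun z => ∑ n ∈ Finset.range N, b n * Complex.exp (-(lam n : ℂ) * z)) ?_ ?_ ?_ h hs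
  · apply Differentiable.diffContOnCl
    fun_prop
  · refine ⟨0, by norm_num, 0, Asymptotics.IsBigO.of_bound (∑ n ∈ Finset.range N, ‖b n‖) ?_⟩
    filter_upwards [mem_inf_of_right (mem_principal_self {z : ℂ | 0 < z.re})] with z hz
    simpa using hbdd z (le_of_lt hz)
  · refine ⟨∑ n ∈ Finset.range N, ‖b n‖, eventually_map.2 ?_⟩
    filter_upwards [eventually_ge_atTop 0] with x hx
    exact hbdd x (by simpa using hx)

/-! ### Characters, trigonometric polynomials and moments on a compact group -/

section Group

variable {G : Type*} [CommGroup G] [TopologicalSpace G] [IsTopologicalGroup G] [CompactSpace G]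
  [MeasurableSpace G] [BorelSpace G]

instance : (haarG G).IsHaarMeasure := by
  unfold haarG
  infer_instance

instance : IsProbabilityMeasure (haarG G) :=
  ⟨by simpa [haarG] using Measure.haarMeasure_self (G := G) (K₀ := ⊤)⟩

/-- A character as a complex-valued continuous function. -/
noncomputable def characterMap {G : Type*} [CommGroup G] [TopologicalSpace G] (χ : G →ₜ* Circle) :
    C(G, ℂ) :=
  ⟨fun ω => (χ ω : ℂ), continuous_subtype_val.comp χ.continuous_toFun⟩

@[simp] lemma characterMap_apply (χ : G →ₜ* Circle) (ω : G) : characterMap χ ω = (χ ω : ℂ) := rfl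

lemma coe_inv_character (χ : G →ₜ* Circle) (ω : G) : ((χ⁻¹ ω : Circle) : ℂ) = conj (χ ω : ℂ) :=
  Circle.coe_inv_eq_conj (χ ω)

/-- Orthogonality: a character other than `1` has mean value `0`. -/
lemma integral_character_of_ne_one {χ : G →ₜ* Circle} (hχ : χ ≠ 1) :
    ∫ ω, (χ ω : ℂ) ∂(haarG G) = 0 := by
  obtain ⟨g, hg⟩ : ∃ g, χ g ≠ 1 := by
    by_contra! h
    exact hχ (ContinuousMonoidHom.ext h)
  have h1 := integral_mul_left_eq_self (μ := haarG G) (fun ω => (χ ω : ℂ)) g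
  simp_rw [map_mul, Circle.coe_mul] at h1
  rw [integral_const_mul] at h1
  have h2 : ((χ g : ℂ) - 1) * ∫ ω, (χ ω : ℂ) ∂(haarG G) = 0 := by
    rw [sub_mul, h1, one_mul, sub_self]
  refine (mul_eq_zero.1 h2).resolve_left fun h => hg ?_
  exact Circle.ext (by simpa using sub_eq_zero.1 h)

open Classical in
lemma fourierCoeffG_character (χ ψ : G →ₜ* Circle) :
    fourierCoeffG (characterMap χ) ψ = if χ = ψ then 1 else 0 := by
  unfold fourierCoeffG
  have h : ∀ ω, characterMap χ ω * conj (ψ ω : ℂ) = ((χ * ψ⁻¹) ω : Circle) := by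
    intro ω
    simp [coe_inv_character]
  simp_rw [h]
  split_ifs with hχ
  · simp [hχ]
  · exact integral_character_of_ne_one fun h => hχ (mul_inv_eq_one.1 h)

/-- The algebra of trigonometric polynomials on `G`. -/
noncomputable def trigSpan (G : Type*) [CommGroup G] [TopologicalSpace G] : Submodule ℂ C(G, ℂ) :=
  Submodule.span ℂ (Set.range characterMap)

lemma characterMap_mem (χ : G →ₜ* Circle) : characterMap χ ∈ trigSpan G :=
  Submodule.subset_span ⟨χ, rfl⟩

/-- Closure under products and conjugation is what admits `conj S ^ (k + 1) * S ^ k` as a test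
function. -/
lemma mul_mem_trigSpan {f g : C(G, ℂ)} (hf : f ∈ trigSpan G) (hg : g ∈ trigSpan G) :
    f * g ∈ trigSpan G := by
  have h := Submodule.mul_mem_mul hf hg
  unfold trigSpan at h ⊢
  rw [Submodule.span_mul_span] at h
  refine Submodule.span_mono ?_ h
  rintro _ ⟨_, ⟨χ, rfl⟩, _, ⟨ψ, rfl⟩, rfl⟩
  exact ⟨χ * ψ, by ext; simp⟩

lemma pow_mem_trigSpan {f : C(G, ℂ)} (hf : f ∈ trigSpan G) (k : ℕ) : f ^ k ∈ trigSpan G := by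
  induction k with
  | zero =>
    rw [pow_zero]
    convert characterMap_mem (1 : G →ₜ* Circle) using 1
    ext
    simp
  | succ k ih => rw [pow_succ]; exact mul_mem_trigSpan ih hf

lemma star_mem_trigSpan {f : C(G, ℂ)} (hf : f ∈ trigSpan G) : star f ∈ trigSpan G := by
  unfold trigSpan at hf
  induction hf using Submodule.span_induction with
  | mem x hx =>
    obtain ⟨χ, rfl⟩ := hx
    convert characterMap_mem χ⁻¹ using 1
    ext
    simp [coe_inv_character]
  | zero => simp
  | add x y _ _ hx hy => rw [star_add]; exact add_mem hx hy
  | smul a x _ hx => rw [star_smul]; exact Submodule.smul_mem _ _ hx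

lemma integrable_continuousMap (g : C(G, ℂ)) : Integrable g (haarG G) :=
  g.continuous.integrable_of_hasCompactSupport (HasCompactSupport.of_compactSpace _)

/-- A continuous function whose even moments are dominated by `c` times the preceding odd moments is
bounded by `c`. -/
lemma norm_le_of_moments (S : C(G, ℂ)) {c : ℝ} (hc : 0 ≤ c)
    (h : ∀ k : ℕ, ∫ ω, ‖S ω‖ ^ (2 * k + 2) ∂(haarG G) ≤ c * ∫ ω, ‖S ω‖ ^ (2 * k + 1) ∂(haarG G))
    (ω : G) : ‖S ω‖ ≤ c := by
  have hint : ∀ k : ℕ, Integrable (fun ω => ‖S ω‖ ^ k) (haarG G) := fun k =>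
    (by fun_prop : Continuous fun ω => ‖S ω‖ ^ k).integrable_of_hasCompactSupport
      (HasCompactSupport.of_compactSpace _)
  by_contra! hω
  obtain ⟨r, hcr, hrω⟩ := exists_between hω
  have hr : 0 < r := hc.trans_lt hcr
  have hmom : ∀ k : ℕ, ∫ ω, ‖S ω‖ ^ (2 * k + 2) ∂(haarG G) ≤ c ^ (2 * k + 2) := by
    intro k
    -- Bernoulli's inequality for `(c / x) ^ (2 * k + 2)`, in place of Hölder. Once integrated, it
    -- combines with `h k` to bound the even moment by `c ^ (2 * k + 2)`.
    have hpt : ∀ x : ℝ, 0 ≤ x → (2 * k + 2 : ℕ) * (c * x ^ (2 * k + 1))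
        - (2 * k + 1 : ℕ) * x ^ (2 * k + 2) ≤ c ^ (2 * k + 2) := by
      intro x hx
      rcases hx.eq_or_lt with rfl | hx
      · simpa using by positivity
      have hb := one_add_mul_le_pow (a := c / x - 1) (by linarith [div_nonneg hc hx.le]) (2 * k + 2)
      rw [add_sub_cancel, div_pow, le_div_iff₀ (by positivity)] at hb
      refine le_trans (le_of_eq ?_) hb
      push_cast
      field_simp
      ring
    have hi := integral_mono (((hint (2 * k + 1)).const_mul c).const_mul ((2 * k + 2 : ℕ) : ℝ) |>.sub
      ((hint (2 * k + 2)).const_mul ((2 * k + 1 : ℕ) : ℝ))) (integrable_const _)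
      (fun ω => hpt ‖S ω‖ (norm_nonneg _))
    rw [integral_sub' (((hint (2 * k + 1)).const_mul c).const_mul _) ((hint (2 * k + 2)).const_mul _),
      integral_const_mul, integral_const_mul, integral_const_mul] at hi
    simp only [integral_const, probReal_univ, one_smul] at hi
    have hk := mul_le_mul_of_nonneg_left (h k) (Nat.cast_nonneg (α := ℝ) (2 * k + 2))
    push_cast at hi hk
    linarith
  -- Chebyshev: `U` is open and non-empty, hence of positive Haar measure, yet its measure is at
  -- most `(c / r) ^ (2 * k + 2)` for every `k`.
  set U : Set G := {x | r < ‖S x‖} with hU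
  have hUo : IsOpen U := isOpen_lt continuous_const (by fun_prop)
  have hUpos : 0 < (haarG G).real U :=
    ENNReal.toReal_pos (hUo.measure_pos _ ⟨ω, hrω⟩).ne' (measure_ne_top _ _)
  have hmk : ∀ k : ℕ, r ^ (2 * k + 2) * (haarG G).real U ≤ c ^ (2 * k + 2) := by
    intro k
    refine le_trans ?_ (hmom k)
    calc r ^ (2 * k + 2) * (haarG G).real U = ∫ _ in U, r ^ (2 * k + 2) ∂(haarG G) := by
          simp [mul_comm]
      _ ≤ ∫ ω in U, ‖S ω‖ ^ (2 * k + 2) ∂(haarG G) := by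
          refine setIntegral_mono_on (by simp) (hint _).integrableOn hUo.measurableSet ?_
          intro x hx
          exact pow_le_pow_left₀ hr.le (le_of_lt hx) _
      _ ≤ _ := setIntegral_le_integral (hint _) (Eventually.of_forall fun x => by positivity)
  have hlim : Tendsto (fun k : ℕ => (c / r) ^ (2 * k + 2)) atTop (𝓝 0) :=
    (tendsto_pow_atTop_nhds_zero_of_lt_one (by positivity) ((div_lt_one hr).2 hcr)).comp
      (tendsto_atTop_mono (fun k => (by omega : k ≤ 2 * k + 2)) tendsto_id)
  have := ge_of_tendsto' hlim (b := (haarG G).real U) fun k => by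
    rw [div_pow, le_div_iff₀ (by positivity), mul_comm]
    exact hmk k
  linarith

end Group
end GeneralDirichlet

/-! ### Partial sums as averages along the flow -/

namespace GeneralDirichlet

set_option linter.unusedSectionVars false
section Group

variable {G : Type*} [CommGroup G] [TopologicalSpace G] [IsTopologicalGroup G] [CompactSpace G]
  [MeasurableSpace G] [BorelSpace G] {lam : ℕ → ℝ}

lemma LambdaDirichletGroup.h_injective (hlam : Function.Injective lam)
    (𝓖 : LambdaDirichletGroup lam G) : Function.Injective 𝓖.h := by
  intro m n hmn
  by_contra hne
  have hsub : lam m - lam n ≠ 0 := sub_ne_zero.2 fun h => hne (hlam h)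
  -- At `t = π / (lam m - lam n)` the two characters of `ℝ` differ by the factor `-1`.
  have h1 : Circle.exp (-(lam m * (Real.pi / (lam m - lam n))))
      = Circle.exp (-(lam n * (Real.pi / (lam m - lam n)))) := by
    rw [← 𝓖.h_β, ← 𝓖.h_β, hmn]
  have h2 : Circle.exp (lam m * (Real.pi / (lam m - lam n))
      - lam n * (Real.pi / (lam m - lam n))) = 1 := by
    rw [Circle.exp_sub, div_eq_one]
    simpa [Circle.exp_neg] using h1
  rw [← sub_mul, mul_div_cancel₀ _ hsub] at h2
  have h3 := congrArg (fun z : Circle => (z : ℂ)) h2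
  simp only [Circle.coe_exp, Complex.exp_pi_mul_I, Circle.coe_one] at h3
  norm_num at h3

/-- The function on `G` associated with the `N`-th partial sum. -/
noncomputable def partialSumMap (𝓖 : LambdaDirichletGroup lam G) (a : ℕ → ℂ) (N : ℕ) : C(G, ℂ) :=
  ∑ n ∈ Finset.range (N + 1), a n • characterMap (𝓖.h n)

lemma partialSumMap_mem (𝓖 : LambdaDirichletGroup lam G) (a : ℕ → ℂ) (N : ℕ) :
    partialSumMap 𝓖 a N ∈ trigSpan G :=
  Submodule.sum_mem _ fun _ _ => Submodule.smul_mem _ _ (characterMap_mem _)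

open Classical in
lemma fourierCoeffG_partialSumMap (𝓖 : LambdaDirichletGroup lam G) (a : ℕ → ℂ) (N : ℕ)
    (χ : G →ₜ* Circle) : fourierCoeffG (partialSumMap 𝓖 a N) χ =
      ∑ n ∈ Finset.range (N + 1), a n * if 𝓖.h n = χ then 1 else 0 := by
  simp_rw [← fourierCoeffG_character]
  unfold fourierCoeffG partialSumMap
  simp_rw [← integral_const_mul]
  rw [← integral_finsetSum]
  · refine integral_congr_ae (Eventually.of_forall fun ω => ?_)
    simp [Finset.sum_mul, mul_assoc]
  · intro n _
    refine Integrable.const_mul ?_ _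
    convert integrable_continuousMap (characterMap (𝓖.h n) * characterMap χ⁻¹) using 1
    ext ω
    simp [coe_inv_character]

lemma fourierCoeffG_partialSumMap_h (hlam : Function.Injective lam) (𝓖 : LambdaDirichletGroup lam G)
    (a : ℕ → ℂ) (N m : ℕ) : fourierCoeffG (partialSumMap 𝓖 a N) (𝓖.h m) = partialSum a N m := by
  rw [fourierCoeffG_partialSumMap]
  simp [(𝓖.h_injective hlam).eq_iff, partialSum]

lemma fourierCoeffG_partialSumMap_of_notMem (𝓖 : LambdaDirichletGroup lam G)
    (a : ℕ → ℂ) (N : ℕ) {χ : G →ₜ* Circle} (hχ : χ ∉ Set.range 𝓖.h) :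
    fourierCoeffG (partialSumMap 𝓖 a N) χ = 0 := by
  rw [fourierCoeffG_partialSumMap]
  refine Finset.sum_eq_zero fun n _ => ?_
  rw [if_neg fun h => hχ ⟨n, h⟩, mul_zero]

lemma fourierCoeffG_congr_ae {f g : G → ℂ} (h : f =ᵐ[haarG G] g) (χ : G →ₜ* Circle) :
    fourierCoeffG f χ = fourierCoeffG g χ :=
  integral_congr_ae (h.mono fun ω hω => by simp only [hω])

lemma isAssociated_partialSum (hlam : Function.Injective lam) (𝓖 : LambdaDirichletGroup lam G)
    (a : ℕ → ℂ) (N : ℕ) :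
    IsAssociated 𝓖 ∞ (partialSum a N)
      (ContinuousMap.toLp ∞ (haarG G) ℂ (partialSumMap 𝓖 a N)) := by
  have h := ContinuousMap.coeFn_toLp (p := ∞) (haarG G) (𝕜 := ℂ) (partialSumMap 𝓖 a N)
  refine ⟨fun χ hχ => ?_, fun n => ?_⟩
  · rw [fourierCoeffG_congr_ae h, fourierCoeffG_partialSumMap_of_notMem _ _ _ hχ]
  · rw [fourierCoeffG_congr_ae h, fourierCoeffG_partialSumMap_h hlam]

lemma integral_partialSumMap_mul_character (𝓖 : LambdaDirichletGroup lam G) (a : ℕ → ℂ) (N : ℕ)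
    (χ : G →ₜ* Circle) : ∫ ω, partialSumMap 𝓖 a N ω * characterMap χ ω ∂(haarG G)
      = fourierCoeffG (partialSumMap 𝓖 a N) χ⁻¹ := by
  simp [fourierCoeffG, coe_inv_character]

/-- The flow on `G` given by the Dirichlet group. -/
noncomputable def LambdaDirichletGroup.flow (𝓖 : LambdaDirichletGroup lam G) (w : ℝ) : G :=
  𝓖.β (Multiplicative.ofAdd (2 * Real.pi * w))

lemma LambdaDirichletGroup.continuous_flow (𝓖 : LambdaDirichletGroup lam G) :
    Continuous 𝓖.flow :=
  𝓖.continuous_β.comp (continuous_ofAdd.comp (by fun_prop))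

/-- Averaging a function in the Hardy space against a kernel along the flow gives the partial sum; here
in the weak sense, tested against trigonometric polynomials. -/
lemma integral_kernel_mul_eq (hlam : Function.Injective lam) (𝓖 : LambdaDirichletGroup lam G)
    {a : ℕ → ℂ} {f : Lp ℂ ∞ (haarG G)} (hf : IsAssociated 𝓖 ∞ a f) {N : ℕ} {V : ℝ → ℂ}
    (hV : Integrable V)
    (hVN : ∀ n, ∫ w, V w * Complex.exp (2 * Real.pi * lam n * w * Complex.I)
      = if n ≤ N then 1 else 0)
    {g : C(G, ℂ)} (hg : g ∈ trigSpan G) :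
    Integrable (fun w => V w * ∫ ω, f ω * g (ω * 𝓖.flow w) ∂(haarG G)) ∧
      ∫ w, V w * ∫ ω, f ω * g (ω * 𝓖.flow w) ∂(haarG G)
        = ∫ ω, partialSumMap 𝓖 a N ω * g ω ∂(haarG G) := by
  have hfint : ∀ (g : C(G, ℂ)) (b : G), Integrable (fun ω => f ω * g (ω * b)) (haarG G) := by
    intro g b
    refine Integrable.mul_bdd (c := ‖g‖) (((Lp.memLp f).mono_exponent le_top).integrable le_rfl)
      (by fun_prop : Continuous fun ω => g (ω * b)).aestronglyMeasurable
      (Eventually.of_forall fun ω => g.norm_coe_le_norm _)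
  unfold trigSpan at hg
  induction hg using Submodule.span_induction with
  | mem x hx =>
    obtain ⟨χ, rfl⟩ := hx
    -- A character splits off the translation, so the `w`-integral becomes the inverse Fourier
    -- transform of `V` at the frequency of `χ⁻¹`; off the spectrum both sides vanish.
    have hΦ : ∀ w, ∫ ω, f ω * characterMap χ (ω * 𝓖.flow w) ∂(haarG G)
        = (χ (𝓖.flow w) : ℂ) * fourierCoeffG f χ⁻¹ := by
      intro w
      unfold fourierCoeffG
      rw [← integral_const_mul]
      refine integral_congr_ae (Eventually.of_forall fun ω => ?_)
      simp only [characterMap_apply, map_mul, Circle.coe_mul, coe_inv_character, Complex.conj_conj]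
      ring
    simp_rw [hΦ]
    refine ⟨?_, ?_⟩
    · refine (hV.mul_const (fourierCoeffG f χ⁻¹)).mono (hV.aestronglyMeasurable.mul
        (Continuous.aestronglyMeasurable ?_)) (Eventually.of_forall fun w => by
          rw [norm_mul, norm_mul, norm_mul, Circle.norm_coe, one_mul])
      exact ((characterMap χ).continuous.comp 𝓖.continuous_flow).mul continuous_const
    · rw [integral_partialSumMap_mul_character]
      by_cases hχ : χ⁻¹ ∈ Set.range 𝓖.h
      · obtain ⟨m, hm⟩ := hχ
        rw [← hm, fourierCoeffG_partialSumMap_h hlam, ← hf.2 m]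
        have hflow : ∀ w, (χ (𝓖.flow w) : ℂ) = Complex.exp (2 * Real.pi * lam m * w * Complex.I) := by
          intro w
          rw [← inv_inv χ, ← hm, coe_inv_character, LambdaDirichletGroup.flow, 𝓖.h_β,
            Circle.coe_exp, ← Complex.exp_conj]
          congr 1
          simp [Complex.conj_ofNat]
          ring
        simp_rw [hflow, ← mul_assoc]
        rw [integral_mul_const, hVN, partialSum]
        split_ifs <;> simp
      · rw [fourierCoeffG_partialSumMap_of_notMem _ _ _ hχ, hf.1 _ hχ]
        simp
  | zero => simp
  | add x y _ _ hx hy =>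
    have e : ∀ w, V w * ∫ ω, f ω * (x + y) (ω * 𝓖.flow w) ∂(haarG G)
        = V w * ∫ ω, f ω * x (ω * 𝓖.flow w) ∂(haarG G)
          + V w * ∫ ω, f ω * y (ω * 𝓖.flow w) ∂(haarG G) := by
      intro w
      simp_rw [ContinuousMap.add_apply, mul_add]
      rw [integral_add (hfint _ _) (hfint _ _), mul_add]
    simp_rw [e, ContinuousMap.add_apply, mul_add]
    refine ⟨hx.1.add hy.1, ?_⟩
    rw [integral_add hx.1 hy.1, hx.2, hy.2, integral_add]
    · exact integrable_continuousMap (partialSumMap 𝓖 a N * x)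
    · exact integrable_continuousMap (partialSumMap 𝓖 a N * y)
  | smul c x _ hx =>
    have e : ∀ w, V w * ∫ ω, f ω * (c • x) (ω * 𝓖.flow w) ∂(haarG G)
        = c * (V w * ∫ ω, f ω * x (ω * 𝓖.flow w) ∂(haarG G)) := by
      intro w
      simp_rw [ContinuousMap.smul_apply, smul_eq_mul, mul_left_comm _ c]
      rw [integral_const_mul, mul_left_comm]
    simp_rw [e, ContinuousMap.smul_apply, smul_eq_mul, mul_left_comm _ c]
    exact ⟨hx.1.const_mul c, by rw [integral_const_mul, integral_const_mul, hx.2]⟩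

/-- By translation invariance, every shift of `g` along the flow has the same `L₁`-norm, so each
inner pairing is at most `‖f‖_∞ ‖g‖₁`. -/
lemma norm_integral_partialSumMap_mul_le (hlam : Function.Injective lam)
    (𝓖 : LambdaDirichletGroup lam G)
    {a : ℕ → ℂ} {f : Lp ℂ ∞ (haarG G)} (hf : IsAssociated 𝓖 ∞ a f) {N : ℕ} {V : ℝ → ℂ}
    (hV : Integrable V)
    (hVN : ∀ n, ∫ w, V w * Complex.exp (2 * Real.pi * lam n * w * Complex.I)
      = if n ≤ N then 1 else 0)
    {g : C(G, ℂ)} (hg : g ∈ trigSpan G) :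
    ‖∫ ω, partialSumMap 𝓖 a N ω * g ω ∂(haarG G)‖
      ≤ ((∫ w, ‖V w‖) * ‖f‖) * ∫ ω, ‖g ω‖ ∂(haarG G) := by
  rw [← (integral_kernel_mul_eq hlam 𝓖 hf hV hVN hg).2, mul_assoc, ← integral_mul_const]
  refine norm_integral_le_of_norm_le (hV.norm.mul_const _) (Eventually.of_forall fun w => ?_)
  rw [norm_mul]
  gcongr
  rw [← integral_mul_right_eq_self (fun ω => ‖g ω‖) (𝓖.flow w), ← integral_const_mul]
  refine norm_integral_le_of_norm_le ?_ ?_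
  · refine Integrable.const_mul ?_ _
    exact (by fun_prop : Continuous fun ω => ‖g (ω * 𝓖.flow w)‖).integrable_of_hasCompactSupport
      (HasCompactSupport.of_compactSpace _)
  · have hfa : ∀ᵐ ω ∂(haarG G), ‖f ω‖ ≤ ‖f‖ := by
      filter_upwards [ae_le_eLpNormEssSup (f := f) (μ := haarG G)] with ω hω
      rw [← eLpNorm_exponent_top, ← Lp.enorm_def, enorm_le_iff_norm_le] at hω
      exact hω
    filter_upwards [hfa] with ω hω
    rw [norm_mul]
    gcongr

/-- With `g = conj S ^ (k + 1) * S ^ k` one has `S * g = |S| ^ (2 * k + 2)` and `|g| = |S| ^ (2 * k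
+ 1)`, so the weak bound becomes the moment hypothesis of `norm_le_of_moments`. No density or
duality argument is needed. -/
theorem norm_partialSumMap_le (hlam : Function.Injective lam) (𝓖 : LambdaDirichletGroup lam G)
    {a : ℕ → ℂ} {f : Lp ℂ ∞ (haarG G)} (hf : IsAssociated 𝓖 ∞ a f) {N : ℕ} {V : ℝ → ℂ}
    (hV : Integrable V)
    (hVN : ∀ n, ∫ w, V w * Complex.exp (2 * Real.pi * lam n * w * Complex.I)
      = if n ≤ N then 1 else 0) (ω : G) :
    ‖partialSumMap 𝓖 a N ω‖ ≤ (∫ w, ‖V w‖) * ‖f‖ := by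
  set S := partialSumMap 𝓖 a N with hS
  have hc : 0 ≤ (∫ w, ‖V w‖) * ‖f‖ :=
    mul_nonneg (integral_nonneg fun _ => norm_nonneg _) (norm_nonneg _)
  refine norm_le_of_moments S hc (fun k => ?_) ω
  have hSm : S ∈ trigSpan G := partialSumMap_mem 𝓖 a N
  have h := norm_integral_partialSumMap_mul_le hlam 𝓖 hf hV hVN
    (mul_mem_trigSpan (pow_mem_trigSpan (star_mem_trigSpan hSm) (k + 1)) (pow_mem_trigSpan hSm k))
  have e1 : ∀ ω, S ω * (star S ^ (k + 1) * S ^ k) ω = ((‖S ω‖ ^ (2 * k + 2) : ℝ) : ℂ) := by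
    intro ω
    have : S ω * conj (S ω) = ((‖S ω‖ ^ 2 : ℝ) : ℂ) := by
      rw [Complex.mul_conj, Complex.normSq_eq_norm_sq]
    rw [show 2 * k + 2 = 2 * (k + 1) by ring, pow_mul]
    push_cast at this ⊢
    rw [← this]
    simp
    ring
  have e2 : ∀ ω, ‖(star S ^ (k + 1) * S ^ k) ω‖ = ‖S ω‖ ^ (2 * k + 1) := by
    intro ω
    simp
    ring
  simp_rw [← hS, e1, e2] at h
  rw [integral_complex_ofReal, Complex.norm_real] at h
  exact (le_abs_self _).trans h

lemma partialSumMap_β (𝓖 : LambdaDirichletGroup lam G) (a : ℕ → ℂ) (N : ℕ) (t : ℝ) :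
    partialSumMap 𝓖 a N (𝓖.β (Multiplicative.ofAdd t)) =
      ∑ n ∈ Finset.range (N + 1), a n * Complex.exp (-(lam n : ℂ) * (t * Complex.I)) := by
  simp only [partialSumMap, ContinuousMap.sum_apply, ContinuousMap.smul_apply, characterMap_apply,
    𝓖.h_β, Circle.coe_exp, smul_eq_mul]
  refine Finset.sum_congr rfl fun n _ => ?_
  congr 2
  push_cast
  ring

/-- Partial sums are controlled by the `L₁`-norm of a kernel separating the frequencies. -/
theorem partialSum_norms_le (hlam : Function.Injective lam) (hpos : ∀ n, 0 ≤ lam n)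
    (𝓖 : LambdaDirichletGroup lam G) {a : ℕ → ℂ} {N : ℕ} {V : ℝ → ℂ}
    (hV : Integrable V)
    (hVN : ∀ n, ∫ w, V w * Complex.exp (2 * Real.pi * lam n * w * Complex.I)
      = if n ≤ N then 1 else 0) {K : ℝ} (hK : 0 < K) (hVK : ∫ w, ‖V w‖ ≤ K) :
    partialSumSupNorm lam a N ≤ ENNReal.ofReal K * hardyNorm 𝓖 ∞ a ∧
      hardyNorm 𝓖 ∞ (partialSum a N) ≤ ENNReal.ofReal K * hardyNorm 𝓖 ∞ a := by
  -- `hardyNorm` is an infimum over associated functions, so a bound by each of them suffices; their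
  -- uniqueness plays no role.
  have hle : ∀ x : ℝ≥0∞, (∀ f, IsAssociated 𝓖 ∞ a f → x ≤ ENNReal.ofReal (K * ‖f‖)) →
      x ≤ ENNReal.ofReal K * hardyNorm 𝓖 ∞ a := by
    intro x hx
    have hK0 : ENNReal.ofReal K ≠ 0 := (ENNReal.ofReal_pos.2 hK).ne'
    rw [mul_comm, ← ENNReal.div_le_iff hK0 ENNReal.ofReal_ne_top, hardyNorm]
    refine le_iInf₂ fun f hf => ?_
    rw [ENNReal.div_le_iff hK0 ENNReal.ofReal_ne_top, mul_comm, ← Lp.enorm_def,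
      ← ofReal_norm, ← ENNReal.ofReal_mul hK.le]
    exact hx f hf
  have hbd : ∀ f, IsAssociated 𝓖 ∞ a f → ∀ ω, ‖partialSumMap 𝓖 a N ω‖ ≤ K * ‖f‖ :=
    fun f hf ω => (norm_partialSumMap_le hlam 𝓖 hf hV hVN ω).trans (by gcongr)
  refine ⟨hle _ fun f hf => ?_, hle _ fun f hf => ?_⟩
  · refine iSup₂_le fun s hs => ?_
    rw [← ofReal_norm]
    refine ENNReal.ofReal_le_ofReal ?_
    refine norm_sum_exp_le_of_imaginary_axis hpos a (N + 1) (fun t => ?_) hs.le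
    rw [← partialSumMap_β 𝓖]
    exact hbd f hf _
  · refine (iInf₂_le _ (isAssociated_partialSum hlam 𝓖 a N)).trans ?_
    rw [eLpNorm_congr_ae (ContinuousMap.coeFn_toLp (haarG G) (partialSumMap 𝓖 a N)),
      eLpNorm_exponent_top]
    refine eLpNormEssSup_le_of_ae_bound (Eventually.of_forall (hbd f hf))

end Group

end GeneralDirichlet

/-! ### Inserting the gap conditions -/

namespace GeneralDirichlet

/-- Partial sums grow at most logarithmically in the reciprocal of the gap that follows `lam N`. -/
theorem partialSum_norms_le_of_gap {G : Type*} [CommGroup G] [TopologicalSpace G]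
    [IsTopologicalGroup G] [CompactSpace G] [MeasurableSpace G] [BorelSpace G] {lam : ℕ → ℝ}
    (hlam : IsFrequency lam) (𝓖 : LambdaDirichletGroup lam G) (a : ℕ → ℂ) (N : ℕ) {C E K : ℝ}
    (hC : 0 < C) (hE : 0 ≤ E) (hgap : C * Real.exp (-E) ≤ lam (N + 1) - lam N)
    (hK : 4 + 4 * lam N + 2 * (E - Real.log (min C 1)) ≤ K) :
    partialSumSupNorm lam a N ≤ ENNReal.ofReal K * hardyNorm 𝓖 ∞ a ∧
      hardyNorm 𝓖 ∞ (partialSum a N) ≤ ENNReal.ofReal K * hardyNorm 𝓖 ∞ a := by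
  -- The flank width is `d = min C 1 * exp (-E)`: truncating `C` at `1` ensures `d ≤ 1`, and `log (1
  -- / d) = E - log (min C 1)`.
  have hC' : 0 < min C 1 := lt_min hC one_pos
  have hlog : Real.log (min C 1) ≤ 0 := Real.log_nonpos hC'.le (min_le_right _ _)
  have hd : 0 < min C 1 * Real.exp (-E) := by positivity
  have hd1 : min C 1 * Real.exp (-E) ≤ 1 :=
    mul_le_one₀ (min_le_right _ _) (Real.exp_pos _).le (Real.exp_le_one_iff.2 (by linarith))
  have hdgap : lam N + min C 1 * Real.exp (-E) ≤ lam (N + 1) := by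
    have : min C 1 * Real.exp (-E) ≤ C * Real.exp (-E) := by
      gcongr
      exact min_le_left _ _
    linarith
  obtain ⟨V, hV, hVn, h1, h0⟩ := exists_kernel (hlam.nonneg N) hd hd1
  have hN := hlam.nonneg N
  refine partialSum_norms_le hlam.strictMono.injective hlam.nonneg 𝓖 hV (fun n => ?_) (by linarith)
    (hVn.trans (le_trans (le_of_eq ?_) hK))
  · split_ifs with hn
    · exact h1 _ (by rw [abs_of_nonneg (hlam.nonneg n)]; exact hlam.strictMono.monotone hn)
    · refine h0 _ (hdgap.trans ?_)
      rw [abs_of_nonneg (hlam.nonneg n)]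
      exact hlam.strictMono.monotone (by omega)
  · rw [one_div, Real.log_inv, Real.log_mul hC'.ne' (Real.exp_pos _).ne', Real.log_exp]
    ring

/-- A positive lower bound for the non-zero frequencies lets additive constants be absorbed into a
multiple of `lam N`. -/
lemma IsFrequency.exists_pos_le {lam : ℕ → ℝ} (hlam : IsFrequency lam) :
    ∃ m, 0 < m ∧ ∀ N, 0 < lam N → m ≤ lam N := by
  rcases (hlam.nonneg 0).eq_or_lt with h | h
  · refine ⟨lam 1, h.trans_lt (hlam.strictMono one_pos), fun N hN => ?_⟩
    refine hlam.strictMono.monotone (Nat.one_le_iff_ne_zero.2 ?_)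
    rintro rfl
    exact hN.ne h
  · exact ⟨lam 0, h, fun N _ => hlam.strictMono.monotone N.zero_le⟩

end GeneralDirichlet


theorem mainTheorem9 (lam : ℕ → ℝ) (hlam : IsFrequency lam) :
    (LandauCondition lam → ∀ δ : ℝ, 0 < δ → ∃ C : ℝ, 0 < C ∧
      ∀ (G : Type u) [CommGroup G] [TopologicalSpace G] [IsTopologicalGroup G] [CompactSpace G]
        [T2Space G] [MeasurableSpace G] [BorelSpace G] (𝓖 : LambdaDirichletGroup lam G)
        (a : ℕ → ℂ), MemHardy 𝓖 ∞ a → ∀ N : ℕ,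
          partialSumSupNorm lam a N
            ≤ ENNReal.ofReal (C * Real.exp (δ * lam N)) * hardyNorm 𝓖 ∞ a ∧
          hardyNorm 𝓖 ∞ (partialSum a N)
            ≤ ENNReal.ofReal (C * Real.exp (δ * lam N)) * hardyNorm 𝓖 ∞ a) ∧
    (BohrCondition lam → ∃ C₁ : ℝ, 0 < C₁ ∧
      ∀ (G : Type u) [CommGroup G] [TopologicalSpace G] [IsTopologicalGroup G] [CompactSpace G]
        [T2Space G] [MeasurableSpace G] [BorelSpace G] (𝓖 : LambdaDirichletGroup lam G)
        (a : ℕ → ℂ), MemHardy 𝓖 ∞ a → ∀ N : ℕ, 0 < lam N →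
          partialSumSupNorm lam a N
            ≤ ENNReal.ofReal (C₁ * lam N) * hardyNorm 𝓖 ∞ a ∧
          hardyNorm 𝓖 ∞ (partialSum a N)
            ≤ ENNReal.ofReal (C₁ * lam N) * hardyNorm 𝓖 ∞ a) := by
  have hlog : ∀ C : ℝ, 0 < C → Real.log (min C 1) ≤ 0 := fun C hC =>
    Real.log_nonpos (lt_min hC one_pos).le (min_le_right _ _)
  refine ⟨fun hLC δ hδ => ?_, fun ⟨l, hl, hBC⟩ => ?_⟩
  · obtain ⟨C, hC, hgap⟩ := hLC δ hδ
    have hL := hlog C hC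
    have hδ' : 0 < 4 / δ := by positivity
    -- With `E = exp (δ * lam N) ≥ 1`: the `6` covers `4 + 2 * E`, the `4 / δ` covers `4 * lam N`,
    -- and the non-negative `-2 * log (min C 1)` is multiplied by `E`.
    refine ⟨6 + 4 / δ - 2 * Real.log (min C 1), by linarith, ?_⟩
    intro G _ _ _ _ _ _ _ 𝓖 a _ N
    refine partialSum_norms_le_of_gap hlam 𝓖 a N hC (Real.exp_pos _).le (hgap N) ?_
    have hN := mul_nonneg hδ.le (hlam.nonneg N)
    have hE1 : 1 ≤ Real.exp (δ * lam N) := Real.one_le_exp hN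
    have hE2 : δ * lam N ≤ Real.exp (δ * lam N) := by linarith [Real.add_one_le_exp (δ * lam N)]
    have h4 : 4 * lam N ≤ 4 / δ * Real.exp (δ * lam N) := by
      calc 4 * lam N = 4 / δ * (δ * lam N) := by field_simp
        _ ≤ _ := by gcongr
    have h5 : 0 ≤ -Real.log (min C 1) * (Real.exp (δ * lam N) - 1) :=
      mul_nonneg (by linarith) (by linarith)
    linarith
  -- Any fixed `δ > 0` would do here: it only changes the constant.
  · obtain ⟨C, hC, hgap⟩ := hBC 1 one_pos
    obtain ⟨m, hm, hmle⟩ := hlam.exists_pos_le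
    have hL := hlog C hC
    have hA : 0 ≤ (4 - 2 * Real.log (min C 1)) / m := div_nonneg (by linarith) hm.le
    -- The first summand absorbs the additive constant through `m ≤ lam N`; the second collects the
    -- terms `4 * lam N` and `2 * E`, with `E = (l + 1) * lam N`.
    refine ⟨(4 - 2 * Real.log (min C 1)) / m + (4 + 2 * (l + 1)), by linarith, ?_⟩
    intro G _ _ _ _ _ _ _ 𝓖 a _ N hN
    refine partialSum_norms_le_of_gap hlam 𝓖 a N hC (E := (l + 1) * lam N) (by positivity)
      (by simpa only [neg_mul] using hgap N) ?_
    have h1 : 4 - 2 * Real.log (min C 1) ≤ (4 - 2 * Real.log (min C 1)) / m * lam N := by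
      calc 4 - 2 * Real.log (min C 1) = (4 - 2 * Real.log (min C 1)) / m * m := by field_simp
        _ ≤ _ := by gcongr; exact hmle N hN
    linarith
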